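/- Let $X$ be a complex Banach space and let $L(X)$ be the algebra of bounded linear operators on $X$, with identity $I$. For $T \in L(X)$ put $\mathrm{comm}(T)=\{S\in L(X) : ST=TS\}$ and $\mathrm{comm}^2(T)=\{S\in L(X) : SU=US \text{ for all } U\in \mathrm{comm}(T)\}$. Call $T$ quasinilpotent if $I+ST$ is invertible in $L(X)$ for every $S\in\mathrm{comm}(T)$. Say that $T$ has a g-Drazin inverse if there is $S\in\mathrm{comm}^2(T)$ such that $S=STS$ and $T-T^2S$ is quasinilpotent, and define the g-Drazin spectrum of $T$ by $$\sigma_d(T)=\{\lambda\in\mathbb{C} : \lambda I-T \text{ has no g-Drazin inverse in } L(X)\}.$$ Let $A,B,C\in L(X)$ satisfy $A(BA)^2=ABACA=ACABA=(AC)^2A$. Then $\sigma_d(AC)=\sigma_d(BA)$. -/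

import Mathlib

namespace GDrazin

/-- The commutant `comm(a)` of an element of a ring. -/
def comm {R : Type*} [Ring R] (a : R) : Set R :=
  {x | x * a = a * x}

/-- The double commutant `comm²(a)` of an element of a ring. -/
def comm2 {R : Type*} [Ring R] (a : R) : Set R :=
  {x | ∀ y ∈ comm a, x * y = y * x}

/-- `a` is quasinilpotent: `1 + x a` is a unit for every `x` commuting with `a`. -/
def IsQuasinilpotent {R : Type*} [Ring R] (a : R) : Prop :=
  ∀ x ∈ comm a, IsUnit (1 + x * a)

/-- `b` is a g-Drazin (generalized Drazin) inverse of `a`. -/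
def IsGDrazinInverse {R : Type*} [Ring R] (a b : R) : Prop :=
  b = b * a * b ∧ b ∈ comm2 a ∧ IsQuasinilpotent (a - a ^ 2 * b)

/-- `a` has a g-Drazin inverse. -/
def HasGDrazinInverse {R : Type*} [Ring R] (a : R) : Prop :=
  ∃ b : R, IsGDrazinInverse a b

/-- The g-Drazin spectrum `σ_d(a)` of an element of a complex unital algebra. -/
def gDrazinSpectrum {A : Type*} [Ring A] [Algebra ℂ A] (a : A) : Set ℂ :=
  {z | ¬ HasGDrazinInverse (algebraMap ℂ A z - a)}

end GDrazin

open Asymptotics Filter Polynomial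

namespace GDrazin

section Banach

variable {R : Type*} [NormedRing R]

/-! The elements `A * C` and `B * A` are shift equivalent: some `l`, `m` intertwine them, and `l *
m`, `m * l` are their `k`-th powers. The g-Drazin spectrum is invariant under this relation.

The invariance rests on an analytic form of g-Drazin invertibility: `b` is invertible modulo an
idempotent `q`, and `b ^ n * q` decays faster than every geometric sequence
(`IsGDrazinInverse.decays`, `HasGDrazinInverse.of_decays`). Such decay survives multiplication by
fixed elements, so `l` and `m` carry it across. At `z = 0` the Drazin inverse itself is transported;
at `z ≠ 0` a polynomial inverse of `z - s` modulo `s ^ k = l * m` is corrected by a term that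
factors through `l` and `m`. -/

/-- A sequence of elements of a normed ring that decays faster than every geometric sequence. -/
def DecaysSuperexponentially (f : ℕ → R) : Prop :=
  ∀ ε : ℝ, 0 < ε → f =O[atTop] fun n => ε ^ n

theorem DecaysSuperexponentially.of_isBigO {f g : ℕ → R} (hg : DecaysSuperexponentially g)
    (h : f =O[atTop] g) : DecaysSuperexponentially f :=
  fun ε hε => h.trans (hg ε hε)

theorem DecaysSuperexponentially.mul_left {f : ℕ → R} (hf : DecaysSuperexponentially f) (x : R) :
    DecaysSuperexponentially fun n => x * f n :=
  hf.of_isBigO ((isBigO_refl f atTop).const_mul_left x)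

theorem DecaysSuperexponentially.mul_right {f : ℕ → R} (hf : DecaysSuperexponentially f) (x : R) :
    DecaysSuperexponentially fun n => f n * x :=
  hf.of_isBigO (IsBigO.of_bound ‖x‖ (Eventually.of_forall fun n => by
    rw [mul_comm ‖x‖]; exact norm_mul_le _ _))

theorem isBigO_pow_norm_pow (x : R) : (fun n : ℕ => x ^ n) =O[atTop] fun n => (‖x‖ + 1) ^ n := by
  refine IsBigO.of_bound 1 ?_
  filter_upwards [eventually_gt_atTop 0] with n hn
  rw [one_mul, Real.norm_of_nonneg (by positivity)]
  exact (norm_pow_le' x hn).trans (by gcongr; linarith)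

theorem DecaysSuperexponentially.mul_pow {f : ℕ → R} (hf : DecaysSuperexponentially f) (x : R) :
    DecaysSuperexponentially fun n => f n * x ^ n := by
  intro ε hε
  have hx : 0 < ‖x‖ + 1 := by positivity
  refine ((hf (ε / (‖x‖ + 1)) (by positivity)).mul (isBigO_pow_norm_pow x)).congr_right fun n => ?_
  rw [← _root_.mul_pow, div_mul_cancel₀ _ hx.ne']

theorem DecaysSuperexponentially.pow_mul {f : ℕ → R} (hf : DecaysSuperexponentially f) (x : R) :
    DecaysSuperexponentially fun n => x ^ n * f n := by
  intro ε hε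
  have hx : 0 < ‖x‖ + 1 := by positivity
  refine ((isBigO_pow_norm_pow x).mul (hf (ε / (‖x‖ + 1)) (by positivity))).congr_right fun n => ?_
  rw [← _root_.mul_pow, mul_div_cancel₀ _ hx.ne']

theorem DecaysSuperexponentially.tendsto_zero {f : ℕ → R} (hf : DecaysSuperexponentially f) :
    Tendsto f atTop (nhds 0) :=
  (hf (1 / 2) (by norm_num)).trans_tendsto
    (tendsto_pow_atTop_nhds_zero_of_lt_one (by norm_num) (by norm_num))

theorem DecaysSuperexponentially.eq_zero_of_const {x : R}
    (h : DecaysSuperexponentially fun _ => x) : x = 0 :=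
  tendsto_nhds_unique tendsto_const_nhds h.tendsto_zero

theorem DecaysSuperexponentially.of_add {f : ℕ → R} (k : ℕ)
    (h : DecaysSuperexponentially fun n => f (n + k)) : DecaysSuperexponentially f := by
  intro ε hε
  rw [← map_add_atTop_eq_nat k, isBigO_map]
  refine (h ε hε).trans (IsBigO.of_bound (ε ^ k)⁻¹ (Eventually.of_forall fun n => ?_))
  simp only [Function.comp_apply, norm_pow, Real.norm_of_nonneg hε.le]
  rw [pow_add, mul_comm (ε ^ n), inv_mul_cancel_left₀ (by positivity)]

/-! ### Quasinilpotence as superexponential decay -/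

/-- For large `n`, `1 - (-a * x) ^ n` is a unit by the Neumann series, and `1 + x * a` is one of its
two commuting factors in the geometric sum identity. -/
theorem IsQuasinilpotent.of_decays [CompleteSpace R] {a : R}
    (h : DecaysSuperexponentially fun n => a ^ n) : IsQuasinilpotent a := by
  intro x hx
  have hc : Commute a (-x) := (Commute.neg_left (show Commute x a from hx)).symm
  have hlim : Tendsto (fun n => (a * -x) ^ n) atTop (nhds 0) := by
    simpa only [hc.mul_pow] using (h.mul_pow (-x)).tendsto_zero
  obtain ⟨n, hn⟩ := ((tendsto_zero_iff_norm_tendsto_zero.1 hlim).eventually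
    (gt_mem_nhds one_pos)).exists
  have hu : IsUnit (1 - (a * -x) ^ n) := isUnit_one_sub_of_norm_lt_one hn
  have hcomm : Commute (1 - a * -x) (∑ i ∈ Finset.range n, (a * -x) ^ i) :=
    Commute.sum_right _ _ _ fun i _ =>
      ((Commute.one_left _).sub_left (Commute.refl _)).pow_right i
  rw [← mul_neg_geom_sum, hcomm.isUnit_mul_iff] at hu
  have : 1 + x * a = 1 - a * -x := by
    rw [mul_neg, sub_neg_eq_add, show x * a = a * x from hx]
  rw [this]
  exact hu.1

/-- Testing against scalars alone leaves only `0` in the spectrum; Gelfand's formula then gives the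
decay. -/
theorem IsQuasinilpotent.decays [NormedAlgebra ℂ R] [CompleteSpace R] {a : R}
    (h : IsQuasinilpotent a) : DecaysSuperexponentially fun n => a ^ n := by
  have hres : ∀ z ∈ spectrum ℂ a, z = 0 := by
    intro z hz
    by_contra hz0
    apply hz
    have hu := h (algebraMap ℂ R (-z⁻¹)) (Algebra.commutes _ _)
    have hz' : IsUnit (algebraMap ℂ R z) := (IsUnit.mk0 z hz0).map _
    have := hz'.mul hu
    rwa [mul_add, mul_one, ← mul_assoc, ← map_mul, mul_neg, mul_inv_cancel₀ hz0, map_neg, map_one,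
      neg_one_mul, ← sub_eq_add_neg] at this
  have hrad : spectralRadius ℂ a = 0 := by
    simp only [spectralRadius, ENNReal.iSup_eq_zero]
    intro z hz
    simp [hres z hz]
  have hlim := spectrum.pow_norm_pow_one_div_tendsto_nhds_spectralRadius a
  rw [hrad] at hlim
  intro ε hε
  refine IsBigO.of_bound 1 ?_
  filter_upwards [hlim.eventually (gt_mem_nhds (ENNReal.ofReal_pos.2 hε)),
    eventually_gt_atTop 0] with n hn hn0
  rw [ENNReal.ofReal_lt_ofReal_iff hε] at hn
  rw [one_mul, Real.norm_of_nonneg (by positivity), ← Real.rpow_natCast]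
  rw [one_div, Real.rpow_inv_lt_iff_of_pos (norm_nonneg _) hε.le (by positivity)] at hn
  exact hn.le

/-- An element that is invertible on the range of `1 - q` and topologically nilpotent on the
range of `q`, where `q` is idempotent, has a g-Drazin inverse. -/
theorem HasGDrazinInverse.of_decays [CompleteSpace R] {b s q : R} (hq : q * q = q)
    (hbs : b * s = 1 - q) (hsb : s * b = 1 - q)
    (hdec : DecaysSuperexponentially fun n => b ^ n * q) : HasGDrazinInverse b := by
  have hcs : Commute b s := hbs.trans hsb.symm
  have hqe : q = 1 - b * s := by rw [hbs]; abel
  have hbq : Commute b q := by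
    rw [hqe]; exact (Commute.one_right _).sub_right ((Commute.refl b).mul_right hcs)
  have hsq : Commute s q := by
    rw [hqe]; exact (Commute.one_right _).sub_right (hcs.symm.mul_right (Commute.refl s))
  have hr : (1 - q) * (1 - q) = 1 - q := by
    rw [mul_sub, sub_mul, sub_mul, hq]; simp
  have hrn : ∀ n : ℕ, (1 - q) = b ^ n * s ^ n * (1 - q) := by
    intro n
    rw [← hcs.mul_pow, hbs, ← pow_succ]
    exact (IsIdempotentElem.pow_succ_eq n hr).symm
  -- The element equals `b ^ n * q * x * s ^ n * (1 - q)` for every `n`. The decay of `b ^ n * q`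
  -- beats the growth of `s ^ n`, so this constant is zero. This and its mirror image put `q` in the
  -- double commutant.
  have hqx : ∀ x, Commute x b → q * x * (1 - q) = 0 := by
    intro x hx
    apply DecaysSuperexponentially.eq_zero_of_const
    have key := ((hdec.mul_right x).mul_pow s).mul_right (1 - q)
    refine key.of_isBigO (IsBigO.of_bound 1 (Eventually.of_forall fun n => le_of_eq ?_))
    rw [one_mul]
    congr 1
    conv_lhs => rw [hrn n]
    rw [(hbq.pow_left n).eq, mul_assoc q (b ^ n) x, ← (hx.pow_right n).eq]
    simp only [mul_assoc]
  have hxq : ∀ x, Commute x b → (1 - q) * x * q = 0 := by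
    intro x hx
    apply DecaysSuperexponentially.eq_zero_of_const
    have key := ((hdec.mul_left x).pow_mul s).mul_left (1 - q)
    refine key.of_isBigO (IsBigO.of_bound 1 (Eventually.of_forall fun n => le_of_eq ?_))
    rw [one_mul]
    congr 1
    have h1 : (1 - q) = (1 - q) * (s ^ n * b ^ n) := by
      have hc : Commute (b ^ n * s ^ n) (1 - q) :=
        (Commute.one_right _).sub_right ((hbq.pow_left n).mul_left (hsq.pow_left n))
      rw [← ((hcs.pow_pow n n)).eq, ← hc.eq, ← hrn n]
    conv_lhs => rw [h1]
    have h2 := (hx.pow_right n).eq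
    simp only [mul_assoc]
    rw [← mul_assoc (b ^ n) x q, ← h2, mul_assoc]
  have hcomm : ∀ x, Commute x b → Commute x q := by
    intro x hx
    have h1 := hqx x hx
    have h2 := hxq x hx
    rw [mul_sub, mul_one, sub_eq_zero] at h1
    rw [sub_mul, one_mul, sub_mul, sub_eq_zero] at h2
    exact h2.trans h1.symm
  have hs' : s * (1 - q) = (1 - q) * s :=
    ((Commute.one_right s).sub_right hsq).eq
  -- `s` need not vanish on the range of `q`, so that part is cut off.
  refine ⟨s * (1 - q), ?_, ?_, ?_⟩
  · have : s * (1 - q) * b * (s * (1 - q)) = s * ((1 - q) * ((b * s) * (1 - q))) := by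
      simp only [mul_assoc]
    rw [this, hbs, hr, hr]
  · intro x hx
    have hxb : Commute x b := hx
    have hxr : (1 - q) * x = x * (1 - q) :=
      (((Commute.one_right x).sub_right (hcomm x hxb)).eq).symm
    calc s * (1 - q) * x = s * (x * ((1 - q) * (1 - q))) := by rw [hr, mul_assoc, hxr]
      _ = s * (x * ((b * s) * (1 - q))) := by rw [hbs]
      _ = s * ((x * b) * s * (1 - q)) := by simp only [mul_assoc]
      _ = (s * b) * x * s * (1 - q) := by rw [hxb.eq]; simp only [mul_assoc]
      _ = x * ((1 - q) * s * (1 - q)) := by rw [hsb, hxr]; simp only [mul_assoc]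
      _ = x * (s * (1 - q)) := by rw [← hs', mul_assoc, hr]
  · have h1 : b - b ^ 2 * (s * (1 - q)) = b * q := by
      have : b ^ 2 * (s * (1 - q)) = b * ((b * s) * (1 - q)) := by
        simp only [pow_two, mul_assoc]
      rw [this, hbs, hr]
      noncomm_ring
    rw [h1]
    apply IsQuasinilpotent.of_decays
    refine hdec.of_isBigO (EventuallyEq.isBigO ?_)
    filter_upwards [eventually_gt_atTop 0] with n hn
    rw [hbq.mul_pow]
    obtain ⟨m, rfl⟩ := Nat.exists_eq_succ_of_ne_zero hn.ne'
    congr 1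
    exact IsIdempotentElem.pow_succ_eq m hq

theorem IsGDrazinInverse.decays [NormedAlgebra ℂ R] [CompleteSpace R] {a d : R}
    (h : IsGDrazinInverse a d) : DecaysSuperexponentially fun n => a ^ n * (1 - a * d) := by
  obtain ⟨h1, h2, h3⟩ := h
  have had : Commute d a := h2 a rfl
  have hp : IsIdempotentElem (1 - a * d) :=
    IsIdempotentElem.one_sub (by
      change a * d * (a * d) = a * d
      rw [mul_assoc, ← mul_assoc d, ← h1])
  have hap : Commute a (1 - a * d) :=
    (Commute.one_right _).sub_right ((Commute.refl a).mul_right had.symm)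
  refine h3.decays.of_isBigO (EventuallyEq.isBigO ?_)
  filter_upwards [eventually_gt_atTop 0] with n hn
  have : a - a ^ 2 * d = a * (1 - a * d) := by noncomm_ring
  rw [this, hap.mul_pow]
  obtain ⟨m, rfl⟩ := Nat.exists_eq_succ_of_ne_zero hn.ne'
  rw [hp.pow_succ_eq]

/-! ### Invariance under shift equivalence -/

theorem pow_mul_intertwine {M : Type*} [Monoid M] {s t l : M} (h : s * l = l * t) (n : ℕ) :
    s ^ n * l = l * t ^ n :=
  ((show SemiconjBy l t s from h.symm).pow_right n).eq.symm

/-- Existence of a g-Drazin inverse is invariant under shift equivalence. -/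
theorem HasGDrazinInverse.of_shiftEquiv [NormedAlgebra ℂ R] [CompleteSpace R] {s t l m : R} {k : ℕ}
    (hl : s * l = l * t) (hm : t * m = m * s) (hlm : l * m = s ^ k) (hml : m * l = t ^ k)
    (h : HasGDrazinInverse t) : HasGDrazinInverse s := by
  obtain ⟨d, hd⟩ := h
  have hdec := hd.decays
  obtain ⟨h1, h2, -⟩ := hd
  have hdt : Commute d t := h2 t rfl
  have hddt : d * (t * d) = d := by rw [← mul_assoc, ← h1]
  have htd : IsIdempotentElem (t * d) := by
    change t * d * (t * d) = t * d
    rw [mul_assoc, hddt]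
  have hpow : t ^ k * d ^ k * (t * d) = t * d := by
    rw [← hdt.symm.mul_pow, ← pow_succ, htd.pow_succ_eq]
  have hd1 : d ^ (k + 1) * (t * d) = d ^ (k + 1) := by rw [pow_succ, mul_assoc, hddt]
  have hdk : t * d ^ (k + 1) = d ^ k * (t * d) := by
    rw [(hdt.symm.pow_right (k + 1)).eq, pow_succ, mul_assoc, hdt.eq]
  have hs1 : s * (l * d ^ (k + 1) * m) = l * (d ^ k * (t * d)) * m := by
    rw [← hdk, ← mul_assoc, ← mul_assoc, hl]; simp only [mul_assoc]
  have hs2 : l * d ^ (k + 1) * m * s = l * (d ^ k * (t * d)) * m := by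
    rw [← hdk, mul_assoc, ← hm, (hdt.symm.pow_right (k + 1)).eq]; simp only [mul_assoc]
  have hc : Commute (d ^ k) (t * d) := (hdt.mul_right (Commute.refl d)).pow_left k
  have htk : t ^ k * (d ^ k * (t * d)) = t * d := by rw [← mul_assoc, hpow]
  have he : l * (d ^ k * (t * d)) * m * (l * (d ^ k * (t * d)) * m)
      = l * (d ^ k * (t * d)) * m := by
    calc _ = l * (d ^ k * (t * d)) * ((m * l) * (d ^ k * (t * d))) * m := by
          simp only [mul_assoc]
      _ = l * (d ^ k * ((t * d) * (t * d))) * m := by rw [hml, htk]; simp only [mul_assoc]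
      _ = _ := by rw [htd]
  -- `d ^ k` inverts `t ^ k = m * l` on the range of `t * d`, so sandwiching it between `l` and `m`
  -- gives an idempotent, on whose range one more factor `d` inverts `s`.
  refine HasGDrazinInverse.of_decays (s := l * d ^ (k + 1) * m)
    (q := 1 - l * (d ^ k * (t * d)) * m) (IsIdempotentElem.one_sub he) ?_ ?_ ?_
  · rw [hs1, sub_sub_cancel]
  · rw [hs2, sub_sub_cancel]
  · refine DecaysSuperexponentially.of_add k ?_
    have : ∀ n, s ^ (n + k) * (1 - l * (d ^ k * (t * d)) * m) = l * (t ^ n * (1 - t * d)) * m := by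
      intro n
      calc _ = s ^ n * (l * m - (l * m) * (l * (d ^ k * (t * d)) * m)) := by
            rw [hlm, pow_add, mul_assoc, mul_sub, mul_one]
        _ = s ^ n * (l * m - l * ((m * l) * (d ^ k * (t * d))) * m) := by simp only [mul_assoc]
        _ = (s ^ n * l) * (1 - t * d) * m := by rw [hml, htk]; noncomm_ring
        _ = _ := by rw [pow_mul_intertwine hl]; simp only [mul_assoc]
    simp only [this]
    exact (hdec.mul_left l).mul_right m

theorem exists_C_sub_X_mul_eq {z : ℂ} (hz : z ≠ 0) (k : ℕ) :
    ∃ c : ℂ[X], (C z - X) * c = 1 - C (z⁻¹ ^ k) * X ^ k := by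
  obtain ⟨c, hc⟩ := sub_dvd_pow_sub_pow (C z : ℂ[X]) X k
  refine ⟨C (z⁻¹ ^ k) * c, ?_⟩
  rw [mul_left_comm, ← hc, mul_sub, ← C_pow, ← C_mul, ← mul_pow, inv_mul_cancel₀ hz]
  simp

/-- Invariance under shift equivalence of the existence of a g-Drazin inverse of `z - t`,
for `z ≠ 0`. -/
theorem HasGDrazinInverse.algebraMap_sub_of_shiftEquiv [NormedAlgebra ℂ R] [CompleteSpace R]
    {s t l m : R} {k : ℕ} {z : ℂ} (hz : z ≠ 0)
    (hl : s * l = l * t) (hm : t * m = m * s) (hlm : l * m = s ^ k) (hml : m * l = t ^ k)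
    (h : HasGDrazinInverse (algebraMap ℂ R z - t)) :
    HasGDrazinInverse (algebraMap ℂ R z - s) := by
  set a := algebraMap ℂ R z - t with ha
  set b := algebraMap ℂ R z - s with hb
  obtain ⟨d, hd⟩ := h
  have hdec := hd.decays
  obtain ⟨h1, h2, h3⟩ := hd
  have hta : Commute t a := (Algebra.commute_algebraMap_right z t).sub_right (Commute.refl t)
  have hda : Commute d a := h2 a rfl
  have hdt : Commute d t := h2 t hta
  have hbl : b * l = l * a := by
    rw [hb, ha, sub_mul, mul_sub, hl, Algebra.commutes]
  have ham : a * m = m * b := by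
    rw [hb, ha, sub_mul, mul_sub, hm, Algebra.commutes]
  set p := 1 - a * d with hp
  have hpp : p * p = p :=
    IsIdempotentElem.one_sub (by
      change a * d * (a * d) = a * d
      rw [mul_assoc, ← mul_assoc d, ← h1])
  have hcp : ∀ x, Commute x a → Commute x d → Commute x p := fun x hxa hxd =>
    (Commute.one_right x).sub_right (hxa.mul_right hxd)
  have hap := hcp a (Commute.refl a) hda.symm
  have htp := hcp t hta hdt.symm
  have hdp := hcp d hda (Commute.refl d)
  -- On the range of `p` this unit agrees with `t = z - a`, so `t` is invertible there.
  have hu : IsUnit (algebraMap ℂ R z - a * p) := by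
    have hx := h3 (algebraMap ℂ R (-z⁻¹)) (Algebra.commutes _ _)
    have := ((IsUnit.mk0 z hz).map (algebraMap ℂ R)).mul hx
    rw [mul_add, mul_one, ← mul_assoc, ← map_mul, mul_neg, mul_inv_cancel₀ hz, map_neg, map_one,
      neg_one_mul, ← sub_eq_add_neg] at this
    convert this using 2
    rw [hp]; noncomm_ring
  obtain ⟨u, hu⟩ := hu
  have hcu : ∀ x, Commute x a → Commute x d → Commute x (↑u⁻¹ : R) := fun x hxa hxd =>
    Commute.units_inv_right (by
      rw [hu]
      exact (Algebra.commute_algebraMap_right z x).sub_right (hxa.mul_right (hcp x hxa hxd)))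
  have htu := hcu t hta hdt.symm
  have hau := hcu a (Commute.refl a) hda.symm
  have hdu := hcu d hda (Commute.refl d)
  have hpu : Commute p (↑u⁻¹ : R) :=
    (Commute.one_left _).sub_left (hau.mul_left hdu)
  have hup : (↑u⁻¹ : R) * t * p = p := by
    have : t * p = u * p := by
      rw [hu, sub_mul, mul_assoc, hpp, ha]; noncomm_ring
    rw [mul_assoc, this, Units.inv_mul_cancel_left]
  -- The inverse of `t ^ k = m * l` on the range of `p`; it makes `l * w * m` idempotent.
  set w := (↑u⁻¹ : R) ^ k * p with hw
  have hwp : w * p = w := by rw [hw, mul_assoc, hpp]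
  have hpw : p * w = w := by rw [hw, ← mul_assoc, (hpu.pow_right k).eq, mul_assoc, hpp]
  have htw : Commute t w := (htu.pow_right k).mul_right htp
  have haw : Commute a w := (hau.pow_right k).mul_right hap
  have hwt : t ^ k * w = p := by
    have : ∀ n : ℕ, ((↑u⁻¹ : R) * t) ^ n * p = p := by
      intro n
      induction n with
      | zero => simp
      | succ n ih => rw [pow_succ, mul_assoc, hup, ih]
    rw [hw, ← mul_assoc, (htu.pow_pow k k).eq, ← htu.symm.mul_pow, this]
  obtain ⟨c, hc⟩ := exists_C_sub_X_mul_eq hz k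
  set κ := algebraMap ℂ R (z⁻¹ ^ k) with hκ
  have hcx : ∀ x : R, (algebraMap ℂ R z - x) * aeval x c = 1 - κ * x ^ k := by
    intro x
    simpa [hκ] using congrArg (aeval x) hc
  have hcc : ∀ x : R, Commute (algebraMap ℂ R z - x) (aeval x c) := by
    intro x
    have := Commute.map (Commute.all (C z - X) c) (aeval x)
    simpa using this
  -- Chosen so that `a * g = κ - w`: the `κ` cancels the error `κ * s ^ k = κ * l * m` of `aeval s
  -- c`, and only `l * w * m` remains.
  set g := κ * d - w * aeval t c with hg
  have hκa : ∀ x, Commute x κ := fun x => Algebra.commute_algebraMap_right _ x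
  have hag' : Commute a g :=
    ((hκa a).mul_right hda.symm).sub_right (haw.mul_right (hcc t))
  have hag : a * g = κ - w := by
    have e1 : a * d = 1 - p := by rw [hp]; abel
    calc a * g = (a * κ) * d - (a * w) * aeval t c := by rw [hg]; noncomm_ring
      _ = κ * (a * d) - w * (a * aeval t c) := by
          rw [(hκa a).eq, haw.eq]; simp only [mul_assoc]
      _ = κ * (1 - p) - w * (1 - κ * t ^ k) := by rw [e1, ha, hcx t]
      _ = κ * (1 - p) - w + (w * κ) * t ^ k := by noncomm_ring
      _ = κ * (1 - p) - w + κ * (t ^ k * w) := by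
          rw [(hκa w).eq, (htw.pow_left k).eq, mul_assoc]
      _ = κ - w := by rw [hwt]; noncomm_ring
  have hkey : 1 - κ * s ^ k + l * (κ - w) * m = 1 - l * w * m := by
    rw [← hlm, mul_sub, (hκa l).eq]; noncomm_ring
  refine HasGDrazinInverse.of_decays (s := aeval s c + l * g * m) (q := l * w * m) ?_ ?_ ?_ ?_
  · calc l * w * m * (l * w * m) = l * (w * ((m * l) * w)) * m := by simp only [mul_assoc]
      _ = l * w * m := by rw [hml, hwt, hwp]
  · calc b * (aeval s c + l * g * m) = b * aeval s c + (b * l) * g * m := by noncomm_ring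
      _ = b * aeval s c + l * (a * g) * m := by rw [hbl]; noncomm_ring
      _ = _ := by rw [hag, hb, hcx s, hkey]
  · calc (aeval s c + l * g * m) * b = aeval s c * b + l * g * (m * b) := by noncomm_ring
      _ = b * aeval s c + l * (g * a) * m := by
          rw [← ham, hb, (hcc s).eq]; noncomm_ring
      _ = _ := by rw [← hag'.eq, hag, hb, hcx s, hkey]
  · have : ∀ n, b ^ n * (l * w * m) = l * (a ^ n * p) * (w * m) := by
      intro n
      calc b ^ n * (l * w * m) = (b ^ n * l) * (p * w) * m := by rw [hpw]; simp only [mul_assoc]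
        _ = _ := by rw [pow_mul_intertwine hbl]; simp only [mul_assoc]
    simp only [this]
    exact (hdec.mul_left l).mul_right (w * m)

theorem gDrazinSpectrum_subset_of_shiftEquiv [NormedAlgebra ℂ R] [CompleteSpace R]
    {s t l m : R} {k : ℕ}
    (hl : s * l = l * t) (hm : t * m = m * s) (hlm : l * m = s ^ k) (hml : m * l = t ^ k) :
    gDrazinSpectrum s ⊆ gDrazinSpectrum t := by
  intro z hz ht
  apply hz
  by_cases h0 : z = 0
  · subst h0
    simp only [map_zero, zero_sub] at ht ⊢
    -- At `z = 0` the elements are `-s` and `-t`; the sign in `m` turns `s ^ k` into `(-s) ^ k`.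
    refine HasGDrazinInverse.of_shiftEquiv (l := l) (m := (-1) ^ k * m) (k := k) ?_ ?_ ?_ ?_ ht
    · rw [neg_mul, mul_neg, hl]
    · have : Commute ((-1 : R) ^ k) t := (Commute.neg_one_left t).pow_left k
      rw [neg_mul, mul_neg, ← mul_assoc, ← this.eq, mul_assoc, hm, mul_assoc]
    · have : Commute ((-1 : R) ^ k) l := (Commute.neg_one_left l).pow_left k
      rw [← mul_assoc, ← this.eq, mul_assoc, hlm, neg_pow s]
    · rw [mul_assoc, hml, neg_pow t]
  · exact ht.algebraMap_sub_of_shiftEquiv h0 hl hm hlm hml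

theorem gDrazinSpectrum_eq_of_shiftEquiv [NormedAlgebra ℂ R] [CompleteSpace R]
    {s t l m : R} {k : ℕ}
    (hl : s * l = l * t) (hm : t * m = m * s) (hlm : l * m = s ^ k) (hml : m * l = t ^ k) :
    gDrazinSpectrum s = gDrazinSpectrum t :=
  (gDrazinSpectrum_subset_of_shiftEquiv hl hm hlm hml).antisymm
    (gDrazinSpectrum_subset_of_shiftEquiv hm hl hml hlm)

end Banach

end GDrazin

theorem theorem3p2 {X : Type*} [NormedAddCommGroup X] [NormedSpace ℂ X] [CompleteSpace X]
    (A B C : X →L[ℂ] X)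
    (h₁ : A * (B * A) ^ 2 = A * B * A * C * A)
    (h₂ : A * B * A * C * A = A * C * A * B * A)
    (h₃ : A * C * A * B * A = (A * C) ^ 2 * A) :
    GDrazin.gDrazinSpectrum (A * C) = GDrazin.gDrazinSpectrum (B * A) := by
  have e₁ : A * B * A * C * A = A * B * A * B * A := by
    rw [← h₁]; simp only [pow_two, mul_assoc]
  have e₂ : A * C * A * B * A = A * B * A * B * A := h₂.symm.trans e₁
  have e₃ : A * C * A * C * A = A * B * A * B * A := by
    rw [← e₂, h₃]; simp only [pow_two, mul_assoc]
  -- With a trailing factor `Y`, the relations become rewrite rules for right-associated words: in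
  -- `A * _ * A * _ * A` every `C` may be replaced by `B`.
  have f₁ : ∀ Y, A * (B * (A * (C * (A * Y)))) = A * (B * (A * (B * (A * Y)))) := fun Y => by
    simpa only [mul_assoc] using congrArg (· * Y) e₁
  have f₂ : ∀ Y, A * (C * (A * (B * (A * Y)))) = A * (B * (A * (B * (A * Y)))) := fun Y => by
    simpa only [mul_assoc] using congrArg (· * Y) e₂
  have f₃ : ∀ Y, A * (C * (A * (C * (A * Y)))) = A * (B * (A * (B * (A * Y)))) := fun Y => by
    simpa only [mul_assoc] using congrArg (· * Y) e₃
  refine GDrazin.gDrazinSpectrum_eq_of_shiftEquiv (k := 5) (l := A * B * A * B * A)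
    (m := B * A * C * A * C) ?_ ?_ ?_ ?_ <;>
  simp only [pow_succ, pow_zero, one_mul, mul_assoc, f₁, f₂, f₃]
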